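/- Let $d \ge 2$, let $\mathbb{T}_d$ be the infinite $d$-ary tree with root $\rho$ (every vertex has exactly $d$ children), and let $\mathbb{T}_d^n$ be the subgraph induced by the vertices within distance $n$ of $\rho$. Let $\mu_{n,d}^{\{0,1\}}$ be the uniform probability law on the (finite, non-empty) set of functions $f : \mathbb{T}_d^n \to \mathbb{Z}$ such that $|f(u)-f(v)| \le 1$ for all adjacent $u, v$ and $f(v) \in \{0,1\}$ for every leaf $v$ (every vertex at distance $n$ from $\rho$). Then $\mu_{n,d}^{\{0,1\}}$ converges in the local weak sense as $n \to \infty$: there is a probability measure $\mu_d^{\{0,1\}}$ on $\mathbb{Z}^{\mathbb{T}_d}$ such that, for every $r \ge 0$, the law of the restriction to $\mathbb{T}_d^r$ of a function with law $\mu_{n,d}^{\{0,1\}}$ (for $n \ge r$) converges weakly, as $n \to \infty$, to the law of the restriction to $\mathbb{T}_d^r$ of a function with law $\mu_d^{\{0,1\}}$. -/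

import Mathlib

open MeasureTheory Filter Topology

namespace TreeLip

/-- The vertices of the `d`-ary tree: finite words over an alphabet of `d` letters. The root is the
empty word, the children of `v` are the words `i :: v`, and the distance of `v` from the root is
the length of `v`. -/
abbrev Vertex (d : ℕ) : Type := List (Fin d)

/-- The infinite `d`-ary tree: every vertex is joined to its `d` children. -/
def tree (d : ℕ) : SimpleGraph (Vertex d) where
  Adj u v := (∃ i, v = i :: u) ∨ (∃ i, u = i :: v)
  symm := ⟨fun _ _ h => h.symm⟩
  loopless := ⟨fun v h => by
    rcases h with ⟨i, hi⟩ | ⟨i, hi⟩ <;> simpa using congrArg List.length hi⟩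

/-- The vertices within distance `n` of the root. -/
def ball (d n : ℕ) : Set (Vertex d) := {v | v.length ≤ n}

/-- The `d`-ary tree of height `n`. -/
def finTree (d n : ℕ) : SimpleGraph (ball d n) := (tree d).induce (ball d n)

/-- `1`-Lipschitz integer-valued functions on a graph. -/
def IsLip {V : Type*} (G : SimpleGraph V) (f : V → ℤ) : Prop :=
  ∀ u v, G.Adj u v → |f u - f v| ≤ 1

/-- The Lipschitz functions on the `d`-ary tree of height `n` whose values on the leaves
(the vertices at distance `n` from the root) belong to `S`. -/
def lipSet (d n : ℕ) (S : Finset ℤ) : Set (ball d n → ℤ) :=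
  {f | IsLip (finTree d n) f ∧ ∀ v : ball d n, v.1.length = n → f v ∈ S}

theorem lipSet_nonempty (d n : ℕ) {S : Finset ℤ} (hS : S.Nonempty) : (lipSet d n S).Nonempty := by
  obtain ⟨s, hs⟩ := hS
  exact ⟨fun _ => s, fun u v _ => by simp, fun _ _ => hs⟩

theorem finite_ball (d n : ℕ) : (ball d n).Finite := List.finite_length_le (Fin d) n

theorem lipSet_finite {d : ℕ} (hd : 2 ≤ d) (n : ℕ) (S : Finset ℤ) : (lipSet d n S).Finite := by
  obtain ⟨B, hB⟩ : ∃ B : ℤ, ∀ s ∈ S, |s| ≤ B := by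
    obtain ⟨B, hB⟩ := (S.image fun s => |s|).bddAbove
    exact ⟨B, fun s hs => hB (by simpa using ⟨s, hs, rfl⟩)⟩
  have key : ∀ f ∈ lipSet d n S, ∀ k : ℕ, ∀ v : ball d n, v.1.length + k = n →
      |f v| ≤ B + k := by
    intro f hf k
    induction k with
    | zero =>
      intro v hv
      simpa using hB _ (hf.2 v (by simpa using hv))
    | succ k ih =>
      intro v hv
      let i : Fin d := ⟨0, by omega⟩
      have hw : (i :: v.1) ∈ ball d n := by
        simp only [ball, Set.mem_ofPred_eq, List.length_cons]; omega
      have h1 := ih ⟨i :: v.1, hw⟩ (by simp only [List.length_cons]; omega)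
      have h2 := hf.1 v ⟨i :: v.1, hw⟩ (Or.inl ⟨i, rfl⟩)
      rw [abs_le] at h1 h2 ⊢
      push_cast
      constructor <;> linarith [h1.1, h1.2, h2.1, h2.2]
  have : Finite (ball d n) := (finite_ball d n).to_subtype
  refine (Set.Finite.pi' (fun _ : ball d n => Set.finite_Icc (-(B + n)) (B + n))).subset ?_
  intro f hf v
  have hv : v.1.length ≤ n := v.2
  have h := key f hf (n - v.1.length) v (by omega)
  have h' : ((n - v.1.length : ℕ) : ℤ) ≤ n := by omega
  rw [abs_le] at h
  exact ⟨by linarith [h.1], by linarith [h.2]⟩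

/-- The uniform law on the Lipschitz functions on the `d`-ary tree of height `n` with leaf values
in the finite non-empty set `S`. -/
noncomputable def lipLaw {d : ℕ} (hd : 2 ≤ d) {S : Finset ℤ} (hS : S.Nonempty) (n : ℕ) :
    ProbabilityMeasure (ball d n → ℤ) :=
  ⟨ProbabilityTheory.uniformOn (lipSet d n S),
    have : Finite (ball d n) := (finite_ball d n).to_subtype
    ProbabilityTheory.isProbabilityMeasure_uniformOn (lipSet_finite hd n S)
      (lipSet_nonempty d n hS)⟩

theorem ball_mono (d r k : ℕ) : ball d r ⊆ ball d (r + k) := fun _ hv =>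
  le_trans hv (Nat.le_add_right r k)

/-- The law on the ball of radius `r` of the restriction of a random function on the ball of
radius `r + k`. -/
noncomputable def restrictLaw {d : ℕ} (r k : ℕ) (μ : ProbabilityMeasure (ball d (r + k) → ℤ)) :
    ProbabilityMeasure (ball d r → ℤ) :=
  μ.map (f := Set.domRestrict₂ (π := fun _ => ℤ) (ball_mono d r k))
    (Set.measurable_restrict₂ (ball_mono d r k)).aemeasurable

/-- The law on the ball of radius `r` of the restriction of a random function on the infinite
`d`-ary tree. -/
noncomputable def restrictLimit {d : ℕ} (r : ℕ) (ν : ProbabilityMeasure (Vertex d → ℤ)) :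
    ProbabilityMeasure (ball d r → ℤ) :=
  ν.map (f := Set.domRestrict (π := fun _ => ℤ) (ball d r))
    (Set.measurable_restrict (ball d r)).aemeasurable

/-- Local weak convergence of random functions on the trees of height `n`, as `n → ∞`, to a random
function on the infinite tree: for every radius `r`, the laws of the restrictions to the ball of
radius `r` around the root converge weakly. -/
def ConvergesLocally {d : ℕ} (μ : ∀ n, ProbabilityMeasure (ball d n → ℤ))
    (ν : ProbabilityMeasure (Vertex d → ℤ)) : Prop :=
  ∀ r, Tendsto (fun k => restrictLaw r k (μ (r + k))) atTop (𝓝 (restrictLimit r ν))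

end TreeLip

namespace TreeLip

/-! Write `x_n i` for `rootCount d {0, 1} n i`. Subtrees below distinct children are independent
given the root value, so `x_(n+1) i` is the `d`-th power of a sum of three neighbouring values of
`x_n`. By the symmetry `i ↦ 1 - i`, the profile of `x_n` is determined up to scale by the ratios
`x_n (-(j+1)) / x_n (-j)`. These evolve by a map that is monotone in every coordinate and start at
zero, so they increase with `n` (`ratio_le_succ`); since `d ≥ 2` they never exceed `1/2`
(`ratio_le_half`). Hence they converge, and the normalised profile converges under a geometric
bound. The probability of seeing `g` on the ball of radius `r` is a product of values of `x_k` over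
level `r`, divided by the total count (`card_extensions`). After normalisation every factor
converges. The geometric bound on the root value also gives tightness, so no mass escapes and a
subsequential limit realises these limiting probabilities. -/

/-! ### Root counts and their symmetry -/

/-- The number of Lipschitz functions on the `d`-ary tree of height `n` with leaf values in `S`
and prescribed root value. -/
noncomputable def rootCount (d : ℕ) (S : Finset ℤ) : ℕ → ℤ → ℕ
  | 0, i => if i ∈ S then 1 else 0
  | n + 1, i => (∑ j ∈ Finset.Icc (i - 1) (i + 1), rootCount d S n j) ^ d

theorem sum_Icc_sub_one_add_one {M : Type*} [AddCommMonoid M] (f : ℤ → M) (i : ℤ) :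
    ∑ j ∈ Finset.Icc (i - 1) (i + 1), f j = f (i - 1) + f i + f (i + 1) := by
  have : Finset.Icc (i - 1) (i + 1) = {i - 1, i, i + 1} := by
    ext j; simp only [Finset.mem_Icc, Finset.mem_insert, Finset.mem_singleton]; omega
  rw [this, Finset.sum_insert, Finset.sum_insert, Finset.sum_singleton, add_assoc]
  · simp
  · simp only [Finset.mem_insert, Finset.mem_singleton]; omega

theorem rootCount_succ (d : ℕ) (S : Finset ℤ) (n : ℕ) (i : ℤ) :
    rootCount d S (n + 1) i =
      (rootCount d S n (i - 1) + rootCount d S n i + rootCount d S n (i + 1)) ^ d := by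
  rw [rootCount, sum_Icc_sub_one_add_one]

theorem rootCount_one_sub (d n : ℕ) (i : ℤ) :
    rootCount d {0, 1} n (1 - i) = rootCount d {0, 1} n i := by
  induction n generalizing i with
  | zero =>
    have : 1 - i ∈ ({0, 1} : Finset ℤ) ↔ i ∈ ({0, 1} : Finset ℤ) := by
      simp only [Finset.mem_insert, Finset.mem_singleton]; omega
    simp only [rootCount, this]
  | succ n ih =>
    rw [rootCount_succ, rootCount_succ, show 1 - i - 1 = 1 - (i + 1) by ring,
      show 1 - i + 1 = 1 - (i - 1) by ring, ih, ih, ih]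
    ring

theorem rootCount_zero_pos (d n : ℕ) : 0 < rootCount d {0, 1} n 0 := by
  induction n with
  | zero => simp [rootCount]
  | succ n ih => rw [rootCount_succ]; positivity

/-! ### Monotonicity and boundedness of the ratios -/

/-- The quotient of consecutive values of `rootCount` at `-(j + 1)` and `-j`. -/
noncomputable def ratio (d : ℕ) : ℕ → ℕ → ℝ
  | 0, _ => 0
  | n + 1, 0 => ((1 + ratio d n 0 + ratio d n 0 * ratio d n 1) / (2 + ratio d n 0)) ^ d
  | n + 1, j + 1 =>
    (ratio d n j * (1 + ratio d n (j + 1) + ratio d n (j + 1) * ratio d n (j + 2)) /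
      (1 + ratio d n j + ratio d n j * ratio d n (j + 1))) ^ d

theorem ratio_nonneg (d n j : ℕ) : 0 ≤ ratio d n j := by
  induction n generalizing j with
  | zero => simp [ratio]
  | succ n ih =>
    cases j with
    | zero =>
      rw [ratio]
      have := ih 0; have := ih 1
      positivity
    | succ j =>
      rw [ratio]
      have := ih j; have := ih (j + 1); have := ih (j + 2)
      positivity

theorem root_ratio_mono {a b a' b' : ℝ} (ha : 0 ≤ a) (hb : 0 ≤ b) (haa : a ≤ a') (hbb : b ≤ b') :
    (1 + a + a * b) / (2 + a) ≤ (1 + a' + a' * b') / (2 + a') := by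
  rw [div_le_div_iff₀ (by linarith) (by linarith)]
  nlinarith [mul_nonneg ha hb, mul_nonneg (sub_nonneg.2 haa) hb,
    mul_nonneg (sub_nonneg.2 hbb) (ha.trans haa),
    mul_nonneg (mul_nonneg (sub_nonneg.2 hbb) (ha.trans haa)) ha]

theorem inner_ratio_mono {a b c a' b' c' : ℝ} (ha : 0 ≤ a) (hb : 0 ≤ b) (hc : 0 ≤ c)
    (haa : a ≤ a') (hbb : b ≤ b') (hcc : c ≤ c') :
    c * (1 + a + a * b) / (1 + c + c * a) ≤ c' * (1 + a' + a' * b') / (1 + c' + c' * a') := by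
  have ha' := ha.trans haa
  have hb' := hb.trans hbb
  have hc' := hc.trans hcc
  calc c * (1 + a + a * b) / (1 + c + c * a)
      ≤ c' * (1 + a + a * b) / (1 + c' + c' * a) := by
        rw [div_le_div_iff₀ (by positivity) (by positivity)]
        have : 0 ≤ (c' - c) * (1 + a + a * b) := mul_nonneg (sub_nonneg.2 hcc) (by positivity)
        linarith
    _ ≤ c' * (1 + a' + a' * b) / (1 + c' + c' * a') := by
        rw [div_le_div_iff₀ (by positivity) (by positivity)]
        -- Here `a` also occurs in the denominator; this product is exactly the difference of the
        -- two cross-multiplied sides.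
        have : 0 ≤ c' * (a' - a) * (1 + b + c' * b) :=
          mul_nonneg (mul_nonneg hc' (sub_nonneg.2 haa)) (by positivity)
        linarith
    _ ≤ c' * (1 + a' + a' * b') / (1 + c' + c' * a') := by gcongr

theorem ratio_le_succ (d n j : ℕ) : ratio d n j ≤ ratio d (n + 1) j := by
  induction n generalizing j with
  | zero => simpa [ratio] using ratio_nonneg d 1 j
  | succ n ih =>
    have h := ratio_nonneg d n
    cases j with
    | zero =>
      rw [ratio, ratio]
      refine pow_le_pow_left₀ ?_ (root_ratio_mono (h 0) (h 1) (ih 0) (ih 1)) d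
      have := h 0; have := h 1
      positivity
    | succ j =>
      rw [ratio, ratio]
      refine pow_le_pow_left₀ ?_ (inner_ratio_mono (h _) (h _) (h _) (ih _) (ih _) (ih _)) d
      have := h j; have := h (j + 1); have := h (j + 2)
      positivity

theorem ratio_le_half {d : ℕ} (hd : 2 ≤ d) (n j : ℕ) : ratio d n j ≤ 1 / 2 := by
  -- With all ratios equal to `1/2`, the bases of the recursion are `7/10` at the root index and
  -- `1/2` at the others; `(7/10)^2 < 1/2` closes the induction.
  have pow_le {x : ℝ} (hx : 0 ≤ x) (hx' : x ≤ 7 / 10) : x ^ d ≤ 1 / 2 :=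
    calc x ^ d ≤ x ^ 2 := pow_le_pow_of_le_one hx (by linarith) hd
      _ ≤ (7 / 10) ^ 2 := by gcongr
      _ ≤ 1 / 2 := by norm_num
  induction n generalizing j with
  | zero => simp [ratio]
  | succ n ih =>
    have h := ratio_nonneg d n
    cases j with
    | zero =>
      rw [ratio]
      have h0 := h 0; have h1 := h 1
      refine pow_le (by positivity) ((root_ratio_mono h0 h1 (ih 0) (ih 1)).trans ?_)
      norm_num
    | succ j =>
      rw [ratio]
      have h0 := h j; have h1 := h (j + 1); have h2 := h (j + 2)
      refine pow_le (by positivity)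
        ((inner_ratio_mono h1 h2 h0 (ih _) (ih _) (ih _)).trans ?_)
      norm_num

/-- The product form avoids the quotient `0 / 0` that occurs far from the leaf values; there `ratio`
starts at the value `0`, the choice that makes the iteration increase. -/
theorem rootCount_neg_succ (d n j : ℕ) :
    (rootCount d {0, 1} n (-(j + 1 : ℕ)) : ℝ) = ratio d n j * rootCount d {0, 1} n (-j) := by
  induction n generalizing j with
  | zero =>
    simp only [rootCount, ratio, zero_mul, Nat.cast_eq_zero, ite_eq_right_iff, Finset.mem_insert,
      Finset.mem_singleton]
    omega
  | succ n ih =>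
    have h := ratio_nonneg d n
    cases j with
    | zero =>
      have h0 := h 0; have h1 := h 1
      have e0 := ih 0
      have e1 := ih 1
      -- The values at `1` and `0` agree, which is the source of the denominator `2 + ratio d n 0`.
      have e2 := rootCount_one_sub d n 0
      rw [rootCount_succ, rootCount_succ, ratio]
      norm_num at e0 e1 e2 ⊢
      rw [e2, e1, e0, ← mul_pow]
      congr 1
      field_simp
      ring
    | succ j =>
      have h0 := h j; have h1 := h (j + 1); have h2 := h (j + 2)
      have e0 := ih j
      have e1 := ih (j + 1)
      have e2 := ih (j + 2)
      rw [rootCount_succ, rootCount_succ, ratio]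
      rw [show (-((j + 1 + 1 : ℕ) : ℤ) - 1) = -((j + 2 + 1 : ℕ) : ℤ) by push_cast; ring,
        show (-((j + 1 + 1 : ℕ) : ℤ) + 1) = -((j + 1 : ℕ) : ℤ) by push_cast; ring,
        show (-((j + 1 : ℕ) : ℤ) - 1) = -((j + 1 + 1 : ℕ) : ℤ) by push_cast; ring,
        show (-((j + 1 : ℕ) : ℤ) + 1) = -(j : ℤ) by push_cast; ring]
      simp only [Nat.cast_pow, Nat.cast_add (R := ℝ)]
      rw [e2, e1, e0, ← mul_pow]
      congr 1
      field_simp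
      ring

/-! ### Limits of the normalised counts -/

/-- The number of Lipschitz functions with root value `i`, relative to root value `0`. -/
noncomputable def relCount (d n : ℕ) (i : ℤ) : ℝ :=
  rootCount d {0, 1} n i / rootCount d {0, 1} n 0

theorem relCount_nonneg (d n : ℕ) (i : ℤ) : 0 ≤ relCount d n i := by
  unfold relCount; positivity

theorem relCount_zero (d n : ℕ) : relCount d n 0 = 1 :=
  div_self (by exact_mod_cast (rootCount_zero_pos d n).ne')

theorem relCount_one_sub (d n : ℕ) (i : ℤ) : relCount d n (1 - i) = relCount d n i := by
  rw [relCount, rootCount_one_sub, relCount]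

theorem relCount_neg (d n k : ℕ) : relCount d n (-k) = ∏ j ∈ Finset.range k, ratio d n j := by
  induction k with
  | zero => simpa using relCount_zero d n
  | succ k ih =>
    rw [Finset.prod_range_succ, ← ih, relCount, rootCount_neg_succ, relCount]
    ring

theorem eq_neg_or_one_sub_neg (i : ℤ) :
    ∃ k : ℕ, i.natAbs ≤ k + 1 ∧ (i = -k ∨ i = 1 - -(k : ℤ)) := by
  rcases le_or_gt i 0 with h | h
  · exact ⟨(-i).toNat, by omega, Or.inl (by omega)⟩
  · exact ⟨(i - 1).toNat, by omega, Or.inr (by omega)⟩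

theorem relCount_le {d : ℕ} (hd : 2 ≤ d) (n : ℕ) (i : ℤ) :
    relCount d n i ≤ 2 * (1 / 2) ^ i.natAbs := by
  obtain ⟨k, hk, h⟩ := eq_neg_or_one_sub_neg i
  have : relCount d n i = relCount d n (-k) := by
    rcases h with rfl | rfl
    · rfl
    · rw [relCount_one_sub]
  rw [this, relCount_neg]
  calc ∏ j ∈ Finset.range k, ratio d n j ≤ ∏ j ∈ Finset.range k, (1 / 2 : ℝ) :=
        Finset.prod_le_prod (fun j _ => ratio_nonneg d n j) fun j _ => ratio_le_half hd n j
    _ = 2 * (1 / 2) ^ (k + 1) := by rw [Finset.prod_const, Finset.card_range]; ring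
    _ ≤ 2 * (1 / 2) ^ i.natAbs := by
        gcongr 2 * ?_
        exact pow_le_pow_of_le_one (by norm_num) (by norm_num) hk

theorem summable_two_mul_half_pow_natAbs :
    Summable fun i : ℤ => 2 * (1 / 2 : ℝ) ^ i.natAbs := by
  apply Summable.of_nat_of_neg <;>
  simpa using (summable_geometric_two).mul_left 2

theorem exists_tendsto_relCount {d : ℕ} (hd : 2 ≤ d) (i : ℤ) :
    ∃ l, Tendsto (fun n => relCount d n i) atTop (𝓝 l) := by
  have hr (j : ℕ) : ∃ l, Tendsto (fun n => ratio d n j) atTop (𝓝 l) :=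
    ⟨_, tendsto_atTop_ciSup (monotone_nat_of_le_succ fun n => ratio_le_succ d n j)
      ⟨1 / 2, by rintro _ ⟨n, rfl⟩; exact ratio_le_half hd n j⟩⟩
  choose l hl using hr
  have hneg (k : ℕ) : Tendsto (fun n => relCount d n (-k)) atTop
      (𝓝 (∏ j ∈ Finset.range k, l j)) := by
    simp_rw [relCount_neg]
    exact tendsto_finsetProd _ fun j _ => hl j
  obtain ⟨k, -, rfl | rfl⟩ := eq_neg_or_one_sub_neg i
  · exact ⟨_, hneg k⟩
  · simp_rw [relCount_one_sub]
    exact ⟨_, hneg k⟩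

theorem exists_tendsto_tsum_relCount {d : ℕ} (hd : 2 ≤ d) :
    ∃ l, l ≠ 0 ∧ Tendsto (fun n => ∑' i, relCount d n i) atTop (𝓝 l) := by
  choose l hl using exists_tendsto_relCount hd
  have h := tendsto_tsum_of_dominated_convergence summable_two_mul_half_pow_natAbs hl
    (Eventually.of_forall fun n i => by
      rw [Real.norm_of_nonneg (relCount_nonneg d n i)]; exact relCount_le hd n i)
  refine ⟨_, ne_of_gt (zero_lt_one.trans_le (ge_of_tendsto' h fun n => ?_)), h⟩
  rw [← relCount_zero d n]
  exact (Summable.of_nonneg_of_le (relCount_nonneg d n) (relCount_le hd n)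
    summable_two_mul_half_pow_natAbs).le_tsum 0 fun i _ => relCount_nonneg d n i

/-- Each extra level raises the previous quotient to the power `d` and multiplies it by the `d`-th
power of three relative counts, which converges to a nonzero limit. This compares the normalisations
at heights `k` and `r + k`. -/
theorem exists_tendsto_rootCount_div_pow {d : ℕ} (hd : 2 ≤ d) (r : ℕ) :
    ∃ l, l ≠ 0 ∧ Tendsto (fun k => (rootCount d {0, 1} (r + k) 0 : ℝ) /
      rootCount d {0, 1} k 0 ^ d ^ r) atTop (𝓝 l) := by
  have hpos (n : ℕ) : (rootCount d {0, 1} n 0 : ℝ) ≠ 0 := by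
    exact_mod_cast (rootCount_zero_pos d n).ne'
  choose h hh using exists_tendsto_relCount hd
  induction r with
  | zero => exact ⟨1, one_ne_zero, by simp [hpos]⟩
  | succ r ih =>
    obtain ⟨l, hl0, hl⟩ := ih
    have hstep : Tendsto (fun k => (relCount d (r + k) (-1) + relCount d (r + k) 0 +
        relCount d (r + k) 1) ^ d) atTop (𝓝 ((h (-1) + h 0 + h 1) ^ d)) := by
      refine Tendsto.pow (((?_ : Tendsto _ _ _).add ?_).add ?_) d <;>
      exact (hh _).comp (tendsto_add_atTop_nat r |>.congr fun k => add_comm k r)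
    refine ⟨(h (-1) + h 0 + h 1) ^ d * l ^ d, mul_ne_zero (pow_ne_zero _ ?_) (pow_ne_zero _ hl0),
      (hstep.mul (hl.pow d)).congr fun k => ?_⟩
    · have h0 (i : ℤ) : 0 ≤ h i := ge_of_tendsto' (hh i) fun n => relCount_nonneg d n i
      have h1 : h 0 = 1 := tendsto_nhds_unique (hh 0) (by simp [relCount_zero])
      have := h0 (-1); have := h0 1
      positivity
    · rw [show r + 1 + k = r + k + 1 by ring, rootCount_succ]
      simp only [relCount]
      have := hpos (r + k); have := hpos k
      rw [← add_div, ← add_div, div_pow, div_pow, ← pow_mul, ← pow_succ]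
      push_cast
      field_simp

/-! ### Counting extensions of a function on a ball -/

/-- The vertices at distance `r` from the root. -/
abbrev Level (d r : ℕ) : Type := List.Vector (Fin d) r

theorem isLip_finTree_iff {d n : ℕ} {f : ball d n → ℤ} :
    IsLip (finTree d n) f ↔ ∀ (v : Vertex d) (i : Fin d) (h : v.length + 1 ≤ n),
      |f ⟨i :: v, h⟩ - f ⟨v, (Nat.le_succ _).trans h⟩| ≤ 1 := by
  constructor
  · intro hf v i h
    exact hf _ _ (Or.inr ⟨i, rfl⟩)
  · rintro hf ⟨u, hu⟩ ⟨v, hv⟩ (⟨i, hi⟩ | ⟨i, hi⟩)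
    · change v = i :: u at hi
      subst hi
      rw [abs_sub_comm]
      exact hf u i hv
    · change u = i :: v at hi
      subst hi
      exact hf v i hu

/-- The Lipschitz functions on the tree of height `n` that agree with `G` on the ball of
radius `r`. -/
noncomputable def extensions {d : ℕ} (hd : 2 ≤ d) (n : ℕ) (S : Finset ℤ) (r : ℕ)
    (G : Vertex d → ℤ) : Finset (ball d n → ℤ) :=
  open Classical in
  (lipSet_finite hd n S).toFinset.filter fun f => ∀ v : ball d n, v.1.length ≤ r → f v = G v

theorem mem_extensions {d : ℕ} {hd : 2 ≤ d} {n : ℕ} {S : Finset ℤ} {r : ℕ}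
    {G : Vertex d → ℤ} {f : ball d n → ℤ} :
    f ∈ extensions hd n S r G ↔
      f ∈ lipSet d n S ∧ ∀ v : ball d n, v.1.length ≤ r → f v = G v := by
  simp [extensions]

/-- Replace the values of `G` on level `r` by those of `c`. -/
def updateLevel {d r : ℕ} (G : Vertex d → ℤ) (c : Level d r → ℤ) (v : Vertex d) : ℤ :=
  if h : v.length = r then c ⟨v, h⟩ else G v

theorem prod_level_succ {d : ℕ} (r : ℕ) {M : Type*} [CommMonoid M] (F : Vertex d → M) :
    ∏ v : Level d (r + 1), F v.1 = ∏ v : Level d r, ∏ i : Fin d, F (i :: v.1) := by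
  rw [← Fintype.prod_prod_type']
  refine (Fintype.prod_bijective (fun p : Level d r × Fin d => (p.2 ::ᵥ p.1 : Level d (r + 1)))
    ⟨?_, ?_⟩ _ _ fun p => ?_).symm
  · rintro ⟨⟨u, hu⟩, i⟩ ⟨⟨v, hv⟩, j⟩ h
    have := congrArg Subtype.val h
    change i :: u = j :: v at this
    simp only [List.cons.injEq] at this
    obtain ⟨rfl, rfl⟩ := this
    rfl
  · rintro ⟨_ | ⟨i, u⟩, hu⟩
    · simp at hu
    · exact ⟨⟨⟨u, by simpa using hu⟩, i⟩, rfl⟩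
  · rfl

/-- Induction from the leaves inward: split the extensions according to their values on level `r +
1`. Those values vary independently, so the sum of products becomes a product of sums, one for each
edge leaving level `r`. -/
theorem card_extensions {d : ℕ} (hd : 2 ≤ d) {n : ℕ} (S : Finset ℤ) (k r : ℕ) (hn : r + k = n)
    (G : Vertex d → ℤ) (hG : ∀ v (i : Fin d), v.length + 1 ≤ r → |G (i :: v) - G v| ≤ 1) :
    (extensions hd n S r G).card = ∏ v : Level d r, rootCount d S k (G v.1) := by
  induction k generalizing r G with
  | zero =>
    obtain rfl : r = n := hn
    simp only [rootCount, Finset.prod_boole, Finset.mem_univ, true_imp_iff]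
    have hlip : IsLip (finTree d r) fun v => G v.1 :=
      isLip_finTree_iff.2 fun v i h => hG v i h
    split_ifs with h
    · rw [Finset.card_eq_one]
      refine ⟨fun v => G v.1, Finset.ext fun f => ?_⟩
      rw [mem_extensions, Finset.mem_singleton]
      constructor
      · rintro ⟨-, hf⟩
        exact funext fun v => hf v v.2
      · rintro rfl
        exact ⟨⟨hlip, fun v hv => h ⟨v.1, hv⟩⟩, fun _ _ => rfl⟩
    · rw [Finset.card_eq_zero, Finset.eq_empty_iff_forall_notMem]
      intro f hf
      rw [mem_extensions] at hf
      refine h fun v => ?_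
      rw [← hf.2 ⟨v.1, v.2.le⟩ v.2.le]
      exact hf.1.2 _ v.2
  | succ k ih =>
    have hrn : r + 1 ≤ n := by omega
    let T : Finset (Level d (r + 1) → ℤ) :=
      Fintype.piFinset fun v => Finset.Icc (G v.1.tail - 1) (G v.1.tail + 1)
    let R (f : ball d n → ℤ) (v : Level d (r + 1)) : ℤ := f ⟨v.1, v.2.le.trans hrn⟩
    have hmaps : Set.MapsTo R (extensions hd n S r G : Set (ball d n → ℤ)) T := by
      intro f hf
      rw [Finset.mem_coe, mem_extensions] at hf
      rw [Finset.mem_coe, Fintype.mem_piFinset]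
      rintro ⟨_ | ⟨i, v⟩, hv⟩
      · simp at hv
      · have hv' : v.length = r := by simpa using hv
        have h1 := isLip_finTree_iff.1 hf.1.1 v i (by omega)
        have hvn : v ∈ ball d n := show v.length ≤ n by omega
        rw [hf.2 ⟨v, hvn⟩ hv'.le, abs_le] at h1
        simp only [Finset.mem_Icc, List.tail_cons, R]
        constructor <;> linarith [h1.1, h1.2]
    have hfiber (c) (hc : c ∈ T) :
        ((extensions hd n S r G).filter fun f => R f = c) =
          extensions hd n S (r + 1) (updateLevel G c) := by
      ext f
      rw [Finset.mem_filter, mem_extensions, mem_extensions, and_assoc]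
      refine and_congr_right fun _ => ⟨?_, fun h => ⟨fun v hv => ?_, funext fun v => ?_⟩⟩
      · rintro ⟨h, rfl⟩ v hv
        by_cases hv' : v.1.length = r + 1
        · simp [updateLevel, hv', R]
        · rw [updateLevel, dif_neg hv']
          exact h v (by omega)
      · rw [h v (by omega), updateLevel, dif_neg (by omega)]
      · have := h ⟨v.1, v.2.le.trans hrn⟩ v.2.le
        rwa [updateLevel, dif_pos v.2] at this
    have hlip (c) (hc : c ∈ T) (v : Vertex d) (i : Fin d) (hv : v.length + 1 ≤ r + 1) :
        |updateLevel G c (i :: v) - updateLevel G c v| ≤ 1 := by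
      have e : updateLevel G c v = G v := dif_neg (by omega)
      rw [e]
      by_cases h : v.length = r
      · have hl : (i :: v).length = r + 1 := by simp [h]
        have := Fintype.mem_piFinset.1 hc ⟨i :: v, hl⟩
        rw [updateLevel, dif_pos hl, abs_le]
        simp only [Finset.mem_Icc, List.tail_cons] at this
        constructor <;> linarith [this.1, this.2]
      · rw [updateLevel, dif_neg (by simpa using h)]
        exact hG v i (by omega)
    rw [Finset.card_eq_sum_card_fiberwise hmaps]
    calc ∑ c ∈ T, ((extensions hd n S r G).filter fun f => R f = c).card
        = ∑ c ∈ T, ∏ v : Level d (r + 1), rootCount d S k (c v) := by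
          refine Finset.sum_congr rfl fun c hc => ?_
          rw [hfiber c hc, ih (r + 1) (by omega) _ (hlip c hc)]
          refine Finset.prod_congr rfl fun v _ => ?_
          rw [updateLevel, dif_pos v.2]
          rfl
      _ = ∏ v : Level d (r + 1), ∑ j ∈ Finset.Icc (G v.1.tail - 1) (G v.1.tail + 1),
            rootCount d S k j := (Finset.prod_univ_sum _ _).symm
      _ = ∏ v : Level d r, rootCount d S (k + 1) (G v.1) := by
          rw [prod_level_succ r fun v => ∑ j ∈ Finset.Icc (G v.tail - 1) (G v.tail + 1),
            rootCount d S k j]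
          simp [rootCount]

/-! ### The uniform law in terms of counts -/

/-- The number of Lipschitz functions on the tree of height `n` with leaf values in `S`. -/
noncomputable def lipCount {d : ℕ} (hd : 2 ≤ d) (n : ℕ) (S : Finset ℤ) : ℕ :=
  (lipSet_finite hd n S).toFinset.card

theorem lipLaw_real_apply {d : ℕ} (hd : 2 ≤ d) {S : Finset ℤ} (hS : S.Nonempty) (n : ℕ)
    (A : Set (ball d n → ℤ)) (E : Finset (ball d n → ℤ))
    (hE : ∀ f, f ∈ E ↔ f ∈ lipSet d n S ∧ f ∈ A) :
    (lipLaw hd hS n : Measure (ball d n → ℤ)).real A = E.card / lipCount hd n S := by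
  classical
  have : Finite (ball d n) := (finite_ball d n).to_subtype
  have hfin := lipSet_finite hd n S
  have hEs : (E : Set (ball d n → ℤ)) = lipSet d n S ∩ A := Set.ext hE
  have h : (lipLaw hd hS n : Measure (ball d n → ℤ)) A = E.card / lipCount hd n S := by
    change ProbabilityTheory.uniformOn (lipSet d n S) A = _
    rw [← ProbabilityTheory.uniformOn_inter_self hfin, ← hEs]
    conv_lhs => rw [← hfin.coe_toFinset]
    rw [ProbabilityTheory.uniformOn_apply_finset, Finset.inter_eq_right.2]
    · rfl
    · intro f hf
      exact hfin.mem_toFinset.2 ((hE f).1 hf).1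
  rw [Measure.real, h]
  simp

theorem lipLaw_real_root {d : ℕ} (hd : 2 ≤ d) {S : Finset ℤ} (hS : S.Nonempty) (n : ℕ) (i : ℤ) :
    (lipLaw hd hS n : Measure (ball d n → ℤ)).real {f | f ⟨[], Nat.zero_le n⟩ = i} =
      rootCount d S n i / lipCount hd n S := by
  rw [lipLaw_real_apply hd hS n _ (extensions hd n S 0 fun _ => i),
    card_extensions hd S n 0 (zero_add n) _ (by simp)]
  · simp
  · intro f
    rw [mem_extensions]
    refine and_congr_right fun _ => ⟨fun h => h _ le_rfl, fun h v hv => ?_⟩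
    rw [← Set.mem_ofPred_eq.mp h]
    congr 1
    exact Subtype.ext (List.eq_nil_of_length_eq_zero (Nat.le_zero.1 hv))

theorem lipCount_pos {d : ℕ} (hd : 2 ≤ d) (n : ℕ) {S : Finset ℤ} (hS : S.Nonempty) :
    0 < lipCount hd n S := by
  rw [lipCount, Finset.card_pos, Set.Finite.toFinset_nonempty]
  exact lipSet_nonempty d n hS

/-- The probabilities of the possible root values add up to one; multiply by the total count. -/
theorem hasSum_rootCount {d : ℕ} (hd : 2 ≤ d) (n : ℕ) {S : Finset ℤ} (hS : S.Nonempty) :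
    HasSum (fun i => (rootCount d S n i : ℝ)) (lipCount hd n S) := by
  have : Finite (ball d n) := (finite_ball d n).to_subtype
  set μ := (lipLaw hd hS n : Measure (ball d n → ℤ))
  let X (f : ball d n → ℤ) : ℤ := f ⟨[], Nat.zero_le n⟩
  have hX : Measurable X := measurable_pi_apply _
  have hu : (⋃ i, X ⁻¹' {i}) = Set.univ := by
    ext f; simp
  have h0 : ∑' i, μ (X ⁻¹' {i}) = 1 := by
    rw [← measure_iUnion (fun i j hij => (Set.disjoint_singleton.2 hij).preimage X)
      fun i => hX (measurableSet_singleton i), hu, measure_univ]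
  have h1 : HasSum (fun i => μ.real (X ⁻¹' {i})) 1 := by
    have := ENNReal.hasSum_toReal (h0.trans_ne ENNReal.one_ne_top)
    rwa [← ENNReal.tsum_toReal_eq fun i => measure_ne_top μ _, h0, ENNReal.toReal_one] at this
  have hpos : (lipCount hd n S : ℝ) ≠ 0 := by exact_mod_cast (lipCount_pos hd n hS).ne'
  have h2 := h1.mul_left (lipCount hd n S : ℝ)
  rw [mul_one] at h2
  refine h2.congr_fun fun i => ?_
  have : μ.real (X ⁻¹' {i}) = _ := lipLaw_real_root hd hS n i
  rw [this]
  field_simp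

theorem tsum_relCount {d : ℕ} (hd : 2 ≤ d) (n : ℕ) :
    ∑' i, relCount d n i = lipCount hd n {0, 1} / rootCount d {0, 1} n 0 :=
  ((hasSum_rootCount hd n (Finset.insert_nonempty 0 {1})).div_const _).tsum_eq

/-! ### Convergence of the local probabilities -/

theorem exists_tendsto_restrictLaw_singleton {d : ℕ} (hd : 2 ≤ d) (r : ℕ) (g : ball d r → ℤ) :
    ∃ p : NNReal, Tendsto (fun k => restrictLaw r k
      (lipLaw hd (S := {0, 1}) (Finset.insert_nonempty 0 {1}) (r + k)) {g}) atTop (𝓝 p) := by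
  classical
  have : Finite (ball d r) := (finite_ball d r).to_subtype
  let G (v : Vertex d) : ℤ := if h : v ∈ ball d r then g ⟨v, h⟩ else 0
  have hGg (v : ball d r) : G v.1 = g v := dif_pos v.2
  have hval (k : ℕ) : ((restrictLaw r k
      (lipLaw hd (S := {0, 1}) (Finset.insert_nonempty 0 {1}) (r + k)) {g} : NNReal) : ℝ) =
      (extensions hd (r + k) {0, 1} r G).card / lipCount hd (r + k) {0, 1} := by
    rw [restrictLaw, ProbabilityMeasure.map_apply _ _ (measurableSet_singleton g)]
    refine lipLaw_real_apply hd _ (r + k) _ _ fun f => ?_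
    rw [mem_extensions]
    refine and_congr_right fun _ => ?_
    rw [Set.mem_preimage, Set.mem_singleton_iff]
    constructor
    · intro h
      funext v
      exact (h ⟨v.1, ball_mono d r k v.2⟩ v.2).trans (hGg v)
    · rintro rfl v hv
      exact (hGg ⟨v.1, hv⟩).symm
  suffices h : ∃ p : ℝ, Tendsto (fun k => ((extensions hd (r + k) {0, 1} r G).card : ℝ) /
      lipCount hd (r + k) {0, 1}) atTop (𝓝 p) by
    obtain ⟨p, hp⟩ := h
    simp_rw [← hval] at hp
    lift p to NNReal using ge_of_tendsto' hp fun k => NNReal.coe_nonneg _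
    exact ⟨p, NNReal.tendsto_coe.1 hp⟩
  by_cases hG : ∀ v (i : Fin d), v.length + 1 ≤ r → |G (i :: v) - G v| ≤ 1
  · choose h hh using exists_tendsto_relCount hd
    obtain ⟨a, ha0, ha⟩ := exists_tendsto_tsum_relCount hd
    obtain ⟨b, hb0, hb⟩ := exists_tendsto_rootCount_div_pow hd r
    have ha' := ha.comp (tendsto_add_atTop_nat r |>.congr fun k => add_comm k r)
    -- Divide numerator and denominator by `rootCount d {0, 1} k 0 ^ d ^ r`, as level `r` has `d ^
    -- r` vertices. The denominator splits into the sum of relative counts at height `r + k` and the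
    -- quotient of the two normalisations.
    refine ⟨_, ((tendsto_finsetProd Finset.univ fun (v : Level d r) _ => hh (G v.1)).div
      (ha'.mul hb) (mul_ne_zero ha0 hb0)).congr fun k => ?_⟩
    have hpos (n : ℕ) : (rootCount d {0, 1} n 0 : ℝ) ≠ 0 := by
      exact_mod_cast (rootCount_zero_pos d n).ne'
    have h1 := hpos k
    have h2 := hpos (r + k)
    have h3 : (lipCount hd (r + k) {0, 1} : ℝ) ≠ 0 := by
      exact_mod_cast (lipCount_pos hd _ (Finset.insert_nonempty 0 {1})).ne'
    rw [card_extensions hd _ k r rfl G hG]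
    simp only [Function.comp_apply, tsum_relCount hd]
    simp only [Pi.div_apply, relCount, Finset.prod_div_distrib,
      Finset.prod_const, Finset.card_univ, card_vector, Fintype.card_fin, Nat.cast_prod]
    field_simp
  -- A non-Lipschitz pattern has no extension.
  · refine ⟨0, tendsto_const_nhds.congr fun k => ?_⟩
    rw [Finset.card_eq_zero.2, Nat.cast_zero, zero_div]
    rw [Finset.eq_empty_iff_forall_notMem]
    intro f hf
    rw [mem_extensions] at hf
    refine hG fun v i hv => ?_
    have h1 : (i :: v).length ≤ r := hv
    have h2 : v.length ≤ r := by omega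
    rw [← hf.2 ⟨i :: v, ball_mono d r k h1⟩ h1, ← hf.2 ⟨v, ball_mono d r k h2⟩ h2]
    exact isLip_finTree_iff.1 hf.1.1 v i (hv.trans (Nat.le_add_right r k))

/-! ### Tightness -/

theorem abs_apply_le_of_isLip {d n : ℕ} {f : ball d n → ℤ} (hf : IsLip (finTree d n) f)
    (v : Vertex d) (hv : v ∈ ball d n) : |f ⟨v, hv⟩| ≤ |f ⟨[], Nat.zero_le n⟩| + v.length := by
  induction v with
  | nil => simp
  | cons i v ih =>
    have h1 := isLip_finTree_iff.1 hf v i hv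
    have h2 := ih ((Nat.le_succ _).trans hv)
    rw [List.length_cons]
    push_cast
    have := abs_sub_abs_le_abs_sub (f ⟨i :: v, hv⟩) (f ⟨v, (Nat.le_succ _).trans hv⟩)
    linarith

/-- Extend a function on a ball to the whole tree by zero. -/
noncomputable def extendZero {d n : ℕ} (f : ball d n → ℤ) (v : Vertex d) : ℤ :=
  open Classical in if h : v ∈ ball d n then f ⟨v, h⟩ else 0

theorem measurable_extendZero (d n : ℕ) :
    Measurable (extendZero : (ball d n → ℤ) → Vertex d → ℤ) := by
  refine measurable_pi_iff.2 fun v => ?_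
  by_cases h : v ∈ ball d n
  · simpa [extendZero, h] using measurable_pi_apply _
  · simp [extendZero, h]

/-- The law on functions on the infinite tree obtained by extending by zero. -/
noncomputable def extendLaw {d n : ℕ} (μ : ProbabilityMeasure (ball d n → ℤ)) :
    ProbabilityMeasure (Vertex d → ℤ) :=
  μ.map (measurable_extendZero d n).aemeasurable

theorem restrictLimit_extendLaw {d : ℕ} (r k : ℕ)
    (μ : ProbabilityMeasure (ball d (r + k) → ℤ)) :
    restrictLimit r (extendLaw μ) = restrictLaw r k μ := by
  apply Subtype.ext
  change Measure.map (Set.domRestrict (π := fun _ => ℤ) (ball d r))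
    (Measure.map extendZero (μ : Measure (ball d (r + k) → ℤ))) =
      Measure.map (Set.domRestrict₂ (π := fun _ => ℤ) (ball_mono d r k))
        (μ : Measure (ball d (r + k) → ℤ))
  rw [Measure.map_map (Set.measurable_restrict (ball d r)) (measurable_extendZero d (r + k))]
  congr 1
  funext f v
  exact dif_pos (ball_mono d r k v.2)

theorem lipLaw_root_le {d : ℕ} (hd : 2 ≤ d) (n : ℕ) (i : ℤ) :
    (lipLaw hd (S := {0, 1}) (Finset.insert_nonempty 0 {1}) n : Measure (ball d n → ℤ))
      {f | f ⟨[], Nat.zero_le n⟩ = i} ≤ ENNReal.ofReal (2 * (1 / 2) ^ i.natAbs) := by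
  refine (ENNReal.le_ofReal_iff_toReal_le (measure_ne_top _ _) (by positivity)).2 ?_
  change Measure.real _ _ ≤ _
  rw [lipLaw_real_root]
  refine le_trans ?_ (relCount_le hd n i)
  have hpos : (0 : ℝ) < rootCount d {0, 1} n 0 := by exact_mod_cast rootCount_zero_pos d n
  unfold relCount
  refine div_le_div_of_nonneg_left (Nat.cast_nonneg _) hpos ?_
  exact le_hasSum (hasSum_rootCount hd n (Finset.insert_nonempty 0 {1})) 0
    fun i _ => Nat.cast_nonneg _

/-- The root value has a summable tail uniform in `n`, and the Lipschitz condition then confines all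
other values to a compact product of intervals growing with depth. -/
theorem isTightMeasureSet_extendLaw {d : ℕ} (hd : 2 ≤ d) :
    IsTightMeasureSet (Set.range fun n =>
      ((extendLaw (lipLaw hd (S := {0, 1}) (Finset.insert_nonempty 0 {1}) n) :
        ProbabilityMeasure (Vertex d → ℤ)) : Measure (Vertex d → ℤ))) := by
  rw [isTightMeasureSet_iff_exists_isCompact_measure_compl_le]
  intro ε hε
  have hsum : ∑' i : ℤ, ENNReal.ofReal (2 * (1 / 2) ^ i.natAbs) ≠ ⊤ :=
    summable_two_mul_half_pow_natAbs.tsum_ofReal_ne_top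
  obtain ⟨s, hs⟩ := ((ENNReal.tendsto_tsum_compl_atTop_zero hsum).eventually
    (ge_mem_nhds hε)).exists
  obtain ⟨B, hB⟩ := (s.image fun i => |i|).bddAbove
  let K : Set (Vertex d → ℤ) :=
    Set.univ.pi fun v => Set.Icc (-(B + v.length)) (B + v.length)
  have hK : IsCompact K := isCompact_univ_pi fun v => (Set.finite_Icc _ _).isCompact
  refine ⟨K, hK, ?_⟩
  rintro _ ⟨n, rfl⟩
  change Measure.map _ (lipLaw hd _ n : Measure (ball d n → ℤ)) Kᶜ ≤ ε
  rw [Measure.map_apply (measurable_extendZero d n) hK.isClosed.measurableSet.compl]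
  change ProbabilityTheory.uniformOn (lipSet d n {0, 1}) _ ≤ ε
  have : Finite (ball d n) := (finite_ball d n).to_subtype
  -- Intersecting with the support makes the Lipschitz bound available.
  rw [← ProbabilityTheory.uniformOn_inter_self (lipSet_finite hd n _)]
  have htail : ProbabilityTheory.uniformOn (lipSet d n {0, 1})
      (⋃ i : {i : ℤ // i ∉ s}, {f | f ⟨[], Nat.zero_le n⟩ = i.1}) ≤ ε :=
    ((measure_iUnion_le _).trans (ENNReal.tsum_le_tsum fun i => lipLaw_root_le hd n _)).trans hs
  refine (measure_mono ?_).trans htail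
  rintro f ⟨hf, hfK⟩
  refine Set.mem_iUnion.2 ⟨⟨f ⟨[], Nat.zero_le n⟩, fun hfs => hfK fun v _ => ?_⟩, rfl⟩
  have hroot : |f ⟨[], Nat.zero_le n⟩| ≤ B := hB (Finset.mem_coe.2 (Finset.mem_image_of_mem _ hfs))
  rw [Set.mem_Icc, ← abs_le]
  by_cases hv : v ∈ ball d n
  · rw [extendZero, dif_pos hv]
    linarith [abs_apply_le_of_isLip hf.1 v hv]
  · rw [extendZero, dif_neg hv, abs_zero]
    linarith [abs_nonneg (f ⟨[], Nat.zero_le n⟩), Int.natCast_nonneg v.length]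

/-! ### Passage to the limit measure -/

/-- On a countable discrete space, convergence of the masses of all points to those of a
probability measure implies weak convergence. -/
theorem tendsto_probabilityMeasure_of_forall_singleton {Ω : Type*} [MeasurableSpace Ω]
    [TopologicalSpace Ω] [DiscreteTopology Ω] [Countable Ω] [OpensMeasurableSpace Ω]
    {μ : ℕ → ProbabilityMeasure Ω} {ν : ProbabilityMeasure Ω}
    (h : ∀ x, Tendsto (fun n => μ n {x}) atTop (𝓝 (ν {x}))) : Tendsto μ atTop (𝓝 ν) := by
  refine IsPiSystem.tendsto_probabilityMeasure_of_tendsto_of_mem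
    (S := Set.range fun x : Ω => {x}) ?_ ?_ ?_ ?_
  · rintro _ ⟨x, rfl⟩ _ ⟨y, rfl⟩ ⟨z, rfl, hz⟩
    exact ⟨z, by simpa using hz⟩
  · rintro _ ⟨x, rfl⟩
    exact (isOpen_discrete _).measurableSet
  · intro u _ x hx
    exact ⟨{x}, ⟨x, rfl⟩, by simp, by simpa using hx⟩
  · rintro _ ⟨x, rfl⟩
    exact h x

end TreeLip

open TreeLip in
theorem theorem2 (d : ℕ) (hd : 2 ≤ d) :
    ∃ ν : ProbabilityMeasure (TreeLip.Vertex d → ℤ),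
      TreeLip.ConvergesLocally
        (TreeLip.lipLaw hd (S := {0, 1}) (Finset.insert_nonempty 0 {1})) ν := by
  set μ := lipLaw hd (S := {0, 1}) (Finset.insert_nonempty 0 {1})
  let S : Set (ProbabilityMeasure (Vertex d → ℤ)) := Set.range fun n => extendLaw (μ n)
  have hcomp : IsCompact (closure S) := by
    refine isCompact_closure_of_isTightMeasureSet ((isTightMeasureSet_extendLaw hd).subset ?_)
    rintro _ ⟨_, ⟨n, rfl⟩, rfl⟩
    exact ⟨n, rfl⟩
  -- A limit along an ultrafilter finer than `atTop` replaces a convergent subsequence. Since the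
  -- local probabilities converge along `atTop` itself, their limits must be those given by `ν`.
  let U : Ultrafilter ℕ := Ultrafilter.of atTop
  obtain ⟨ν, -, hν⟩ := hcomp.ultrafilter_le_nhds (U.map fun n => extendLaw (μ n))
    (le_principal_iff.2 (Ultrafilter.mem_map.2
      (univ_mem' fun n => subset_closure (Set.mem_range_self n))))
  have hU : Tendsto (fun n => extendLaw (μ n)) U (𝓝 ν) := hν
  refine ⟨ν, fun r => ?_⟩
  have : Finite (ball d r) := (finite_ball d r).to_subtype
  refine tendsto_probabilityMeasure_of_forall_singleton fun g => ?_
  have hlim : Tendsto (fun n => restrictLimit r (extendLaw (μ n)) {g}) U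
      (𝓝 (restrictLimit r ν {g})) :=
    ProbabilityMeasure.tendsto_measure_of_isClopen_of_tendsto
      (ProbabilityMeasure.tendsto_map_of_tendsto_of_continuous _ _ hU
        (Pi.continuous_domRestrict (ball d r))) (isClopen_discrete {g})
  obtain ⟨p, hp⟩ := exists_tendsto_restrictLaw_singleton hd r g
  have hp' : Tendsto (fun n => restrictLimit r (extendLaw (μ n)) {g}) atTop (𝓝 p) := by
    refine (tendsto_add_atTop_iff_nat r).1 (hp.congr fun k => ?_)
    rw [add_comm k r, restrictLimit_extendLaw]
  rwa [tendsto_nhds_unique hlim (hp'.mono_left (Ultrafilter.of_le atTop))]
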